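/- Let $\phi$ be the standard normal density, $G$ the Laplace distribution with density $\gamma(u)=\tfrac12e^{-|u|}$, and $g=\phi*G$. For $n\ge 1$ and $\theta\in\mathbb{R}^n$ let $P_\theta$ (with expectation $E_\theta$) be the law of $X=(X_1,\dots,X_n)$ with independent $X_i\sim\mathcal N(\theta_i,1)$, and let $\ell_0[s]=\{\theta\in\mathbb{R}^n:\ \#\{i:\theta_i\ne 0\}\le s\}$. For $\alpha\in[0,1]$ consider the spike and slab prior $\Pi_\alpha=\bigotimes_{i=1}^n\{(1-\alpha)\delta_0+\alpha G\}$ on $\theta$. By Bayes' formula its posterior is $$\Pi_\alpha[\cdot\,|\,X]=\bigotimes_{i=1}^n\{(1-a_\alpha(X_i))\delta_0+a_\alpha(X_i)G_{X_i}\},\qquad a_\alpha(x)=\frac{\alpha g(x)}{(1-\alpha)\phi(x)+\alpha g(x)},$$ where $G_x$ has density $u\mapsto\phi(x-u)\gamma(u)/g(x)$. For $\alpha\in(0,1]$ let $t(\alpha)\ge0$ be the threshold such that the median of the coordinate posterior $(1-a_\alpha(x))\delta_0+a_\alpha(x)G_x$ is $0$ if and only if $|x|\le t(\alpha)$, and let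 $\alpha_n\in(0,1]$ be defined by $t(\alpha_n)=\sqrt{2\log n}$. Let $\hat\alpha=\hat\alpha(X)$ be a maximiser over $\alpha\in[\alpha_n,1]$ of the log-marginal likelihood $$\ell_n(\alpha;X)=\sum_{i=1}^n\log\big((1-\alpha)\phi(X_i)+\alpha g(X_i)\big).$$ Theorem. There exist $D>0$, $N_0>0$ and $c_0>0$ such that for all $n\ge N_0$ and all integers $s_n$ with $1\le s_n\le c_0n$ there exists $\theta_0\in\ell_0[s_n]$ such that $$E_{\theta_0}\int\|\theta-\theta_0\|^2\,d\Pi_{\hat\alpha}[\theta\,|\,X]\ \ge\ D\,s_n\,e^{\sqrt{\log(n/s_n)}}.$$ In particular, this posterior is suboptimal compared with the minimax rate $s_n\log(n/s_n)$: for every $K>0$ there is $c>0$ such that for all $n\ge N_0$ and all integers $s_n$ with $1\le s_n\le cn$ there is $\theta_0\in\ell_0[s_n]$ with $$E_{\theta_0}\int\|\theta-\theta_0\|^2\,d\Pi_{\hat\alpha}[\theta\,|\,X]\ \ge\ K\,s_n\log(n/s_n).$$ Here $\|\cdot\|$ is the Euclidean norm, and $\theta_0$ does not depend on the choice of the maximiser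 $\hat\alpha$ (which is unique for almost every $X$). -/

import Mathlib

open MeasureTheory ProbabilityTheory

namespace SpikeSlab

noncomputable section

/-- The standard normal density `φ`. -/
def phi (x : ℝ) : ℝ := gaussianPDFReal 0 1 x

/-- The density `γ` of the Laplace distribution with parameter `1`. -/
def laplaceDensity (u : ℝ) : ℝ := Real.exp (-|u|) / 2

/-- The slab distribution `G`, the Laplace distribution with parameter `1`. -/
def slab : Measure ℝ := volume.withDensity fun u => ENNReal.ofReal (laplaceDensity u)

/-- The convolution `g = φ * G`. -/
def g (x : ℝ) : ℝ := ∫ u, phi (x - u) ∂slab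

/-- The marginal density `(1 - α) φ(x) + α g(x)` of one observation, when its mean has the
spike and slab prior `(1 - α) δ₀ + α G`. -/
def marginalDensity (α x : ℝ) : ℝ := (1 - α) * phi x + α * g x

/-- The posterior weight `a_α(x)` of the slab. -/
def slabWeight (α x : ℝ) : ℝ := α * g x / marginalDensity α x

/-- The distribution `G_x`, with density `u ↦ φ(x - u) γ(u) / g(x)`. -/
def slabPosterior (x : ℝ) : Measure ℝ :=
  volume.withDensity fun u => ENNReal.ofReal (phi (x - u) * laplaceDensity u / g x)

/-- The posterior distribution of one coordinate, `(1 - a_α(x)) δ₀ + a_α(x) G_x`. -/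
def coordPosterior (α x : ℝ) : Measure ℝ :=
  ENNReal.ofReal (1 - slabWeight α x) • Measure.dirac 0 +
    ENNReal.ofReal (slabWeight α x) • slabPosterior x

/-- The posterior distribution `Π_α[· | X = x]` on `ℝⁿ` of the spike and slab prior
`⨂ᵢ ((1 - α) δ₀ + α G)`, given by Bayes' formula. -/
def posterior {n : ℕ} (α : ℝ) (x : Fin n → ℝ) : Measure (Fin n → ℝ) :=
  Measure.pi fun i => coordPosterior α (x i)

/-- `m` is a median of `μ`. -/
def IsMedian (μ : Measure ℝ) (m : ℝ) : Prop :=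
  1 / 2 ≤ μ (Set.Iic m) ∧ 1 / 2 ≤ μ (Set.Ici m)

/-- `t` is the threshold `t(α)`: the coordinatewise posterior median vanishes exactly for the
observations `x` with `|x| ≤ t`. -/
def IsMedianThreshold (α t : ℝ) : Prop :=
  0 ≤ t ∧ ∀ x : ℝ, IsMedian (coordPosterior α x) 0 ↔ |x| ≤ t

/-- The lower end point `α_n`, the (unique) weight in `(0, 1]` with `t(α_n) = √(2 log n)`. -/
def alphaLower (n : ℕ) : ℝ :=
  sInf {α | α ∈ Set.Ioc (0 : ℝ) 1 ∧ IsMedianThreshold α (Real.sqrt (2 * Real.log n))}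

/-- The log-marginal likelihood `ℓ_n(α; x)`. -/
def logMarginalLikelihood {n : ℕ} (x : Fin n → ℝ) (α : ℝ) : ℝ :=
  ∑ i, Real.log (marginalDensity α (x i))

/-- `α` maximises the log-marginal likelihood over `[α_n, 1]`. -/
def IsMMLE {n : ℕ} (x : Fin n → ℝ) (α : ℝ) : Prop :=
  α ∈ Set.Icc (alphaLower n) 1 ∧
    IsMaxOn (logMarginalLikelihood x) (Set.Icc (alphaLower n) 1) α

/-- The law `P_θ` of `X = θ + ε`, with `ε` a standard normal vector. -/
def law {n : ℕ} (θ : Fin n → ℝ) : Measure (Fin n → ℝ) :=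
  Measure.pi fun i => gaussianReal (θ i) 1

/-- The class `ℓ₀[s]` of vectors with at most `s` nonzero coordinates. -/
def nearlyBlack (n s : ℕ) : Set (Fin n → ℝ) :=
  {θ | (Finset.univ.filter fun i => θ i ≠ 0).card ≤ s}

/-- The expected posterior second moment `E_{θ₀} ∫ ‖θ - θ₀‖² dΠ_{α̂}(θ | X)` of the plug-in
posterior, with the squared Euclidean norm, as an element of `[0, ∞]`. -/
def expectedSecondMoment {n : ℕ} (αhat : (Fin n → ℝ) → ℝ) (θ₀ : Fin n → ℝ) : ENNReal :=
  ∫⁻ x, ∫⁻ θ, ENNReal.ofReal (∑ i, (θ i - θ₀ i) ^ 2) ∂(posterior (αhat x) x) ∂(law θ₀)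

end

end SpikeSlab

/-!
The log-marginal likelihood is concave in `α`, so the estimator exceeds `α` as soon as the score at
`α` is positive. The score of a null coordinate has mean minus `∫ α (g - φ)² / m_α`. As the Laplace
slab has only exponential tails, at `α = exp (-T² / 2)` this is of the order of `exp (-T)` up to
a small loss in the exponent, whereas a coordinate with a very strong signal has score close to
`1 / α`. Hence by Chebyshev's inequality `s` strong signals push the estimator above
`α = (s / n) exp √(log (n / s))` with probability at least `1 / 2`. Each null coordinate then has
posterior second moment at least of order `α`, whatever its observation, which adds up to `n α`.
-/

namespace SpikeSlab

open Filter Topology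
open scoped NNReal

lemma integral_exp_neg_mul_abs {c : ℝ} (hc : 0 < c) : ∫ x : ℝ, Real.exp (-c * |x|) = 2 / c := by
  rw [integral_comp_abs (f := fun x => Real.exp (-c * x)), integral_exp_mul_Ioi (neg_lt_zero.2 hc)]
  simp [div_eq_mul_inv]

lemma integrable_exp_neg_mul_abs {c : ℝ} (hc : 0 < c) :
    Integrable fun x : ℝ => Real.exp (-c * |x|) :=
  .of_integral_ne_zero (by rw [integral_exp_neg_mul_abs hc]; positivity)

lemma exp_le_half_of_le_neg_one {x : ℝ} (hx : x ≤ -1) : Real.exp x ≤ 1 / 2 := by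
  rw [← neg_neg x, Real.exp_neg, one_div]
  exact inv_anti₀ two_pos (by linarith [Real.add_one_le_exp (-x)])

lemma tendsto_integral_gaussianReal_atTop {E : Type*} [NormedAddCommGroup E] [NormedSpace ℝ E]
    [CompleteSpace E] {f : ℝ → E} {C : ℝ} {l : E} (v : ℝ≥0) (hf : StronglyMeasurable f)
    (hC : ∀ x, ‖f x‖ ≤ C) (hl : Tendsto f atTop (𝓝 l)) :
    Tendsto (fun θ => ∫ x, f x ∂gaussianReal θ v) atTop (𝓝 l) := by
  have hshift (θ : ℝ) : ∫ x, f x ∂gaussianReal θ v = ∫ x, f (θ + x) ∂gaussianReal 0 v := by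
    have hmap := gaussianReal_map_const_add (μ := 0) (v := v) θ
    rw [zero_add] at hmap
    rw [← hmap, integral_map (by fun_prop) hf.aestronglyMeasurable]
  have hlim : Tendsto (fun θ => ∫ x, f (θ + x) ∂gaussianReal 0 v) atTop
      (𝓝 (∫ _, l ∂gaussianReal 0 v)) :=
    tendsto_integral_filter_of_dominated_convergence (fun _ => C)
      (.of_forall fun θ => (hf.comp_measurable (measurable_const_add θ)).aestronglyMeasurable)
      (.of_forall fun θ => ae_of_all _ fun x => hC (θ + x)) (integrable_const C)
      (ae_of_all _ fun x => hl.comp (tendsto_atTop_add_const_right _ x tendsto_id))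
  simpa [hshift] using hlim

lemma tendsto_variance_gaussianReal_atTop {f : ℝ → ℝ} {C l : ℝ} (v : ℝ≥0) (hf : Measurable f)
    (hC : ∀ x, |f x| ≤ C) (hl : Tendsto f atTop (𝓝 l)) :
    Tendsto (fun θ => Var[f; gaussianReal θ v]) atTop (𝓝 0) := by
  have hvar (θ : ℝ) : Var[f; gaussianReal θ v] =
      ∫ x, f x ^ 2 ∂gaussianReal θ v - (∫ x, f x ∂gaussianReal θ v) ^ 2 :=
    variance_eq_sub (memLp_of_bounded (ae_of_all _ fun x => abs_le.1 (hC x))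
      hf.aestronglyMeasurable 2)
  have hmean := tendsto_integral_gaussianReal_atTop v hf.stronglyMeasurable hC hl
  have hsq : Tendsto (fun θ => ∫ x, f x ^ 2 ∂gaussianReal θ v) atTop (𝓝 (l ^ 2)) :=
    tendsto_integral_gaussianReal_atTop (C := C ^ 2) v (hf.pow_const 2).stronglyMeasurable
      (fun x => by rw [norm_pow]; exact pow_le_pow_left₀ (norm_nonneg _) (hC x) 2) (hl.pow 2)
  simpa [hvar] using hsq.sub (hmean.pow 2)

lemma measure_pi_sum_nonpos_le {ι : Type*} [Fintype ι] {Ω : ι → Type*}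
    [∀ i, MeasurableSpace (Ω i)] {μ : ∀ i, Measure (Ω i)} [∀ i, IsProbabilityMeasure (μ i)]
    {X : ∀ i, Ω i → ℝ} (hX : ∀ i, MemLp (X i) 2 (μ i)) {m : ℝ} (hm : 0 < m)
    (hmean : m ≤ ∑ i, ∫ y, X i y ∂μ i) :
    Measure.pi μ {x | ∑ i, X i (x i) ≤ 0} ≤ ENNReal.ofReal ((∑ i, Var[X i; μ i]) / m ^ 2) := by
  set Z : (∀ i, Ω i) → ℝ := ∑ i, fun x => X i (x i) with hZ
  have hXi (i : ι) : MemLp (fun x : ∀ i, Ω i => X i (x i)) 2 (Measure.pi μ) :=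
    (hX i).comp_measurePreserving (measurePreserving_eval μ i)
  have hint : ∫ x, Z x ∂Measure.pi μ = ∑ i, ∫ y, X i y ∂μ i := by
    simp only [hZ, Finset.sum_apply]
    rw [integral_finsetSum _ fun i _ => (hXi i).integrable one_le_two]
    exact Finset.sum_congr rfl fun i _ => integral_comp_eval (hX i).aestronglyMeasurable
  rw [← variance_sum_pi hX]
  refine le_trans (measure_mono fun x hx => ?_)
    (meas_ge_le_variance_div_sq (memLp_finsetSum' _ fun i _ => hXi i) hm)
  have hZx : Z x ≤ 0 := by
    simpa only [hZ, Finset.sum_apply] using (show ∑ i, X i (x i) ≤ 0 from hx)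
  change m ≤ |Z x - ∫ x, Z x ∂Measure.pi μ|
  rw [hint]
  exact le_trans (by linarith) (neg_le_abs _)

lemma exists_forall_of_eventually_sqrt_log {p : ℝ → Prop} (hp : ∀ᶠ r in atTop, p r) :
    ∃ c > 0, ∀ x y : ℝ, 0 < x → x ≤ c * y →
      p √(Real.log (y / x)) ∧ y = x * Real.exp (√(Real.log (y / x)) ^ 2) := by
  obtain ⟨R, hR⟩ := eventually_atTop.1 hp
  refine ⟨Real.exp (-R ^ 2), Real.exp_pos _, fun x y hx hxy => ?_⟩
  have hdiv : Real.exp (R ^ 2) ≤ y / x := by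
    rw [le_div_iff₀ hx]
    calc Real.exp (R ^ 2) * x ≤ Real.exp (R ^ 2) * (Real.exp (-R ^ 2) * y) := by gcongr
      _ = y := by rw [← mul_assoc, ← Real.exp_add, add_neg_cancel, Real.exp_zero, one_mul]
  have hpos : 0 < y / x := (Real.exp_pos _).trans_le hdiv
  have hlog : R ^ 2 ≤ Real.log (y / x) := (Real.le_log_iff_exp_le hpos).2 hdiv
  refine ⟨hR _ (Real.le_sqrt_of_sq_le hlog), ?_⟩
  rw [Real.sq_sqrt ((sq_nonneg R).trans hlog), Real.exp_log hpos, mul_div_cancel₀ _ hx.ne']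

/-! ### Densities -/

lemma phi_eq (x : ℝ) : phi x = (√(2 * Real.pi))⁻¹ * Real.exp (-(x ^ 2 / 2)) := by
  simp [phi, gaussianPDFReal_def, neg_div]

lemma phi_pos (x : ℝ) : 0 < phi x := gaussianPDFReal_pos 0 1 x one_ne_zero

@[fun_prop]
lemma measurable_phi : Measurable phi := measurable_gaussianPDFReal 0 1

lemma integrable_phi : Integrable phi := integrable_gaussianPDFReal 0 1

lemma integral_phi : ∫ x, phi x = 1 := integral_gaussianPDFReal_eq_one 0 one_ne_zero

lemma phi_le_exp (x : ℝ) : phi x ≤ Real.exp (-(x ^ 2 / 2)) := by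
  have h : 1 ≤ √(2 * Real.pi) := Real.one_le_sqrt.2 (by linarith [Real.pi_gt_three])
  rw [phi_eq]
  exact mul_le_of_le_one_left (Real.exp_pos _).le (inv_le_one_of_one_le₀ h)

lemma exp_div_three_le_phi (x : ℝ) : Real.exp (-(x ^ 2 / 2)) / 3 ≤ phi x := by
  have h : √(2 * Real.pi) ≤ 3 := Real.sqrt_le_iff.2 ⟨by norm_num, by linarith [Real.pi_lt_d2]⟩
  rw [phi_eq, div_eq_inv_mul]
  gcongr

lemma phi_le_one (x : ℝ) : phi x ≤ 1 :=
  (phi_le_exp x).trans (Real.exp_le_one_iff.2 (by linarith [sq_nonneg x]))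

lemma phi_le_exp_two_sub (x : ℝ) : phi x ≤ Real.exp (2 - 2 * |x|) := by
  refine (phi_le_exp x).trans (Real.exp_le_exp.2 ?_)
  nlinarith [sq_nonneg (|x| - 2), sq_abs x]

lemma laplaceDensity_pos (u : ℝ) : 0 < laplaceDensity u := by
  unfold laplaceDensity; positivity

@[fun_prop]
lemma measurable_laplaceDensity : Measurable laplaceDensity := by
  unfold laplaceDensity; fun_prop

lemma integrable_laplaceDensity : Integrable laplaceDensity := by
  have h := (integrable_exp_neg_mul_abs one_pos).div_const 2
  simp only [neg_one_mul] at h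
  exact h

lemma integral_laplaceDensity : ∫ u, laplaceDensity u = 1 := by
  have h := integral_exp_neg_mul_abs one_pos
  simp only [neg_one_mul, div_one] at h
  simp only [laplaceDensity, integral_div, h]
  norm_num

instance : IsProbabilityMeasure slab := by
  refine ⟨?_⟩
  rw [slab, withDensity_apply _ MeasurableSet.univ, Measure.restrict_univ,
    ← ofReal_integral_eq_lintegral_ofReal integrable_laplaceDensity
      (ae_of_all _ fun u => (laplaceDensity_pos u).le),
    integral_laplaceDensity, ENNReal.ofReal_one]

lemma phi_mul_laplaceDensity_pos (x u : ℝ) : 0 < phi (x - u) * laplaceDensity u :=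
  mul_pos (phi_pos _) (laplaceDensity_pos u)

lemma integrable_phi_mul_laplaceDensity (x : ℝ) :
    Integrable fun u => phi (x - u) * laplaceDensity u := by
  refine integrable_laplaceDensity.mono' (by fun_prop) (ae_of_all _ fun u => ?_)
  rw [Real.norm_of_nonneg (phi_mul_laplaceDensity_pos x u).le]
  exact mul_le_of_le_one_left (laplaceDensity_pos u).le (phi_le_one _)

lemma g_eq_integral (x : ℝ) : g x = ∫ u, phi (x - u) * laplaceDensity u := by
  rw [g, slab, integral_withDensity_eq_integral_toReal_smul (by fun_prop)
    (ae_of_all _ fun _ => ENNReal.ofReal_lt_top)]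
  refine integral_congr_ae (ae_of_all _ fun u => ?_)
  simp [ENNReal.toReal_ofReal (laplaceDensity_pos u).le, mul_comm]

lemma g_nonneg (x : ℝ) : 0 ≤ g x := integral_nonneg fun _ => (phi_pos _).le

lemma ofReal_g (x : ℝ) : ENNReal.ofReal (g x) = ∫⁻ u, ENNReal.ofReal (phi (x - u)) ∂slab := by
  have hint : Integrable (fun u => phi (x - u)) slab :=
    .of_bound (measurable_phi.comp (measurable_const_sub x)).aestronglyMeasurable 1
      (ae_of_all _ fun u => by rw [Real.norm_of_nonneg (phi_pos _).le]; exact phi_le_one _)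
  exact ofReal_integral_eq_lintegral_ofReal hint (ae_of_all _ fun _ => (phi_pos _).le)

@[fun_prop]
lemma measurable_g : Measurable g := by
  have h : g = fun x => (∫⁻ u, ENNReal.ofReal (phi (x - u)) ∂slab).toReal := by
    ext x
    rw [← ofReal_g, ENNReal.toReal_ofReal (g_nonneg x)]
  rw [h]
  exact (Measurable.lintegral_prod_right'
    (f := fun p : ℝ × ℝ => ENNReal.ofReal (phi (p.1 - p.2))) (by fun_prop)).ennreal_toReal

lemma g_le_exp (x : ℝ) : g x ≤ Real.exp (2 - |x|) := by
  calc g x = ∫ u, phi (x - u) * laplaceDensity u := g_eq_integral x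
    _ ≤ ∫ u, Real.exp (2 - |x|) * laplaceDensity (x - u) := by
        refine integral_mono (integrable_phi_mul_laplaceDensity x)
          ((integrable_laplaceDensity.comp_sub_left x).const_mul _) fun u => ?_
        have htri : |x| ≤ |x - u| + |u| := by simpa using abs_add_le (x - u) u
        calc phi (x - u) * laplaceDensity u
            ≤ Real.exp (2 - 2 * |x - u|) * laplaceDensity u :=
              mul_le_mul_of_nonneg_right (phi_le_exp_two_sub _) (laplaceDensity_pos u).le
          _ = Real.exp (2 - 2 * |x - u| + -|u|) / 2 := by
              rw [laplaceDensity, Real.exp_add, mul_div_assoc]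
          _ ≤ Real.exp (2 - |x| + -|x - u|) / 2 := by gcongr Real.exp ?_ / 2; linarith
          _ = Real.exp (2 - |x|) * laplaceDensity (x - u) := by
              rw [laplaceDensity, Real.exp_add, mul_div_assoc]
    _ = Real.exp (2 - |x|) := by
        rw [integral_const_mul, integral_sub_left_eq_self laplaceDensity volume x,
          integral_laplaceDensity, mul_one]

lemma integrable_g : Integrable g := by
  refine ((integrable_exp_neg_mul_abs one_pos).const_mul (Real.exp 2)).mono' (by fun_prop)
    (ae_of_all _ fun x => ?_)
  rw [Real.norm_of_nonneg (g_nonneg x), ← Real.exp_add, neg_one_mul]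
  exact g_le_exp x

lemma integral_g : ∫ x, g x = 1 := by
  have h : ∫⁻ x, ENNReal.ofReal (g x) = 1 := by
    simp_rw [ofReal_g]
    rw [lintegral_lintegral_swap (by fun_prop)]
    have hphi (u : ℝ) : ∫⁻ x, ENNReal.ofReal (phi (x - u)) = 1 := by
      rw [lintegral_sub_right_eq_self (fun y => ENNReal.ofReal (phi y)) u]
      exact lintegral_gaussianPDFReal_eq_one 0 one_ne_zero
    simp [hphi]
  rw [integral_eq_lintegral_of_nonneg_ae (ae_of_all _ g_nonneg) (by fun_prop), h,
    ENNReal.toReal_one]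

lemma exp_div_six_le_phi_mul_laplaceDensity {x u : ℝ} (hu : |x - u| ≤ 2) :
    Real.exp (-4 - |x|) / 6 ≤ phi (x - u) * laplaceDensity u := by
  have hphi : Real.exp (-2) / 3 ≤ phi (x - u) := by
    refine le_trans ?_ (exp_div_three_le_phi _)
    gcongr
    nlinarith [abs_le.1 hu]
  have hlap : Real.exp (-2 - |x|) / 2 ≤ laplaceDensity u := by
    have htri : |u| ≤ |x| + |x - u| := by simpa using abs_sub x (x - u)
    unfold laplaceDensity
    gcongr
    linarith
  calc Real.exp (-4 - |x|) / 6 = Real.exp (-2) / 3 * (Real.exp (-2 - |x|) / 2) := by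
        rw [show -4 - |x| = -2 + (-2 - |x|) by ring, Real.exp_add]; ring
    _ ≤ phi (x - u) * laplaceDensity u := mul_le_mul hphi hlap (by positivity) (phi_pos _).le

lemma exp_div_six_le_g (x : ℝ) : Real.exp (-4 - |x|) / 6 ≤ g x := by
  rw [g_eq_integral]
  calc Real.exp (-4 - |x|) / 6 = ∫ _ in Set.Icc x (x + 1), Real.exp (-4 - |x|) / 6 := by simp
    _ ≤ ∫ u in Set.Icc x (x + 1), phi (x - u) * laplaceDensity u :=
        setIntegral_mono_on (integrable_const _) (integrable_phi_mul_laplaceDensity x).integrableOn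
          measurableSet_Icc fun u hu => exp_div_six_le_phi_mul_laplaceDensity
            (abs_le.2 ⟨by linarith [hu.2], by linarith [hu.1]⟩)
    _ ≤ ∫ u, phi (x - u) * laplaceDensity u :=
        setIntegral_le_integral (integrable_phi_mul_laplaceDensity x)
          (ae_of_all _ fun u => (phi_mul_laplaceDensity_pos x u).le)

lemma g_pos (x : ℝ) : 0 < g x := lt_of_lt_of_le (by positivity) (exp_div_six_le_g x)

lemma tendsto_phi_div_g_atTop : Tendsto (fun x => phi x / g x) atTop (𝓝 0) := by
  have hlim : Tendsto (fun x : ℝ => 6 * Real.exp 4 * Real.exp (-x)) atTop (𝓝 0) := by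
    simpa using Real.tendsto_exp_neg_atTop_nhds_zero.const_mul (6 * Real.exp 4)
  refine squeeze_zero' (.of_forall fun x => (div_pos (phi_pos x) (g_pos x)).le) ?_ hlim
  filter_upwards [eventually_ge_atTop 4] with x hx
  rw [div_le_iff₀ (g_pos x)]
  calc phi x ≤ Real.exp (-(x ^ 2 / 2)) := phi_le_exp x
    _ ≤ Real.exp (4 + -x + (-4 - |x|)) := by
        rw [abs_of_nonneg (by linarith)]
        gcongr
        nlinarith
    _ = 6 * Real.exp 4 * Real.exp (-x) * (Real.exp (-4 - |x|) / 6) := by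
        rw [Real.exp_add, Real.exp_add]; ring
    _ ≤ 6 * Real.exp 4 * Real.exp (-x) * g x := by gcongr; exact exp_div_six_le_g x

lemma marginalDensity_pos {α : ℝ} (h0 : 0 ≤ α) (h1 : α ≤ 1) (x : ℝ) :
    0 < marginalDensity α x := by
  have hphi := phi_pos x
  have hg := g_pos x
  unfold marginalDensity
  rcases h0.eq_or_lt with rfl | h
  · simpa using hphi
  · nlinarith [mul_pos h hg]

lemma marginalDensity_le_exp {α : ℝ} (h0 : 0 ≤ α) (h1 : α ≤ 1) (x : ℝ) :
    marginalDensity α x ≤ Real.exp (2 - |x|) := by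
  have hphi : phi x ≤ Real.exp (2 - |x|) :=
    (phi_le_exp_two_sub x).trans (Real.exp_le_exp.2 (by linarith [abs_nonneg x]))
  unfold marginalDensity
  nlinarith [g_le_exp x]

@[fun_prop]
lemma measurable_marginalDensity (α : ℝ) : Measurable (marginalDensity α) := by
  unfold marginalDensity; fun_prop

lemma phi_le_two_mul_marginalDensity {α : ℝ} (h0 : 0 ≤ α) (h1 : α ≤ 1 / 2) (x : ℝ) :
    phi x ≤ 2 * marginalDensity α x := by
  unfold marginalDensity
  nlinarith [phi_pos x, mul_nonneg h0 (g_nonneg x)]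

lemma mul_g_le_marginalDensity {α : ℝ} (h1 : α ≤ 1) (x : ℝ) :
    α * g x ≤ marginalDensity α x := by
  unfold marginalDensity
  nlinarith [phi_pos x]

/-! ### The score -/

/-- The score function `β(x, α)` of one observation, the derivative in `α` of
`log ((1 - α) φ(x) + α g(x))`. -/
noncomputable def score (α x : ℝ) : ℝ := (g x - phi x) / marginalDensity α x

/-- The function `(g - φ) - φ · β(·, α)`. As `g` and `φ` have the same mass, its integral is the
deficit of the mean of the score under the standard normal distribution. -/
noncomputable def scoreDeficit (α x : ℝ) : ℝ := α * (g x - phi x) ^ 2 / marginalDensity α x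

@[fun_prop]
lemma measurable_score (α : ℝ) : Measurable (score α) := by
  unfold score; fun_prop

@[fun_prop]
lemma measurable_scoreDeficit (α : ℝ) : Measurable (scoreDeficit α) := by
  unfold scoreDeficit; fun_prop

lemma abs_score_le {α : ℝ} (h0 : 0 < α) (h1 : α ≤ 1 / 2) (x : ℝ) : |score α x| ≤ 1 / α := by
  have hm := marginalDensity_pos h0.le (by linarith) x
  have hphi : α * phi x ≤ marginalDensity α x := by
    nlinarith [phi_le_two_mul_marginalDensity h0.le h1 x]
  have hg : α * g x ≤ marginalDensity α x := mul_g_le_marginalDensity (by linarith) x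
  rw [score, abs_div, abs_of_pos hm, div_le_div_iff₀ hm h0, one_mul, ← abs_of_pos h0, ← abs_mul,
    abs_of_pos h0, abs_le]
  constructor <;> nlinarith [phi_pos x, g_pos x]

lemma memLp_score {α : ℝ} (h0 : 0 < α) (h1 : α ≤ 1 / 2) (p : ENNReal) (μ : Measure ℝ)
    [IsFiniteMeasure μ] : MemLp (score α) p μ :=
  memLp_of_bounded (ae_of_all _ fun x => abs_le.1 (abs_score_le h0 h1 x))
    (measurable_score α).aestronglyMeasurable p

lemma tendsto_score_atTop {α : ℝ} (h0 : α ≠ 0) : Tendsto (score α) atTop (𝓝 (1 / α)) := by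
  have hscore : score α = fun x => (1 - phi x / g x) / ((1 - α) * (phi x / g x) + α) := by
    ext x
    have hg := (g_pos x).ne'
    rw [score, marginalDensity, ← div_div_div_cancel_right₀ hg, sub_div, div_self hg, add_div,
      mul_div_assoc, mul_div_cancel_right₀ _ hg]
  rw [hscore]
  have hnum := tendsto_phi_div_g_atTop.const_sub 1
  have hden := (tendsto_phi_div_g_atTop.const_mul (1 - α)).add_const α
  rw [sub_zero] at hnum
  rw [mul_zero, zero_add] at hden
  exact hnum.div hden h0

lemma exists_score_moments {α : ℝ} (h0 : 0 < α) (h1 : α ≤ 1 / 2) :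
    ∃ t, 1 / (2 * α) ≤ ∫ x, score α x ∂gaussianReal t 1 ∧
      Var[score α; gaussianReal t 1] ≤ 1 / (64 * α ^ 2) := by
  have hmean := tendsto_integral_gaussianReal_atTop 1 (measurable_score α).stronglyMeasurable
    (abs_score_le h0 h1) (tendsto_score_atTop h0.ne')
  have hvar := tendsto_variance_gaussianReal_atTop 1 (measurable_score α)
    (abs_score_le h0 h1) (tendsto_score_atTop h0.ne')
  have hlt : 1 / (2 * α) < 1 / α := one_div_lt_one_div_of_lt h0 (by linarith)
  exact ((hmean.eventually_const_le hlt).and (hvar.eventually_le_const (by positivity))).exists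

lemma scoreDeficit_nonneg {α : ℝ} (h0 : 0 ≤ α) (h1 : α ≤ 1) (x : ℝ) : 0 ≤ scoreDeficit α x :=
  div_nonneg (mul_nonneg h0 (sq_nonneg _)) (marginalDensity_pos h0 h1 x).le

lemma phi_mul_score {α : ℝ} (h0 : 0 ≤ α) (h1 : α ≤ 1) (x : ℝ) :
    phi x * score α x = g x - phi x - scoreDeficit α x := by
  have h := (marginalDensity_pos h0 h1 x).ne'
  unfold score scoreDeficit
  field_simp
  unfold marginalDensity
  ring

lemma phi_mul_score_sq_le {α : ℝ} (h0 : 0 < α) (h1 : α ≤ 1 / 2) (x : ℝ) :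
    phi x * score α x ^ 2 ≤ 2 / α * scoreDeficit α x := by
  have hm := marginalDensity_pos h0.le (by linarith) x
  calc phi x * score α x ^ 2 ≤ 2 * marginalDensity α x * score α x ^ 2 := by
        gcongr; exact phi_le_two_mul_marginalDensity h0.le h1 x
    _ = 2 / α * scoreDeficit α x := by
        unfold score scoreDeficit
        field_simp

lemma scoreDeficit_le_add_g {α : ℝ} (h0 : 0 ≤ α) (h1 : α ≤ 1 / 2) (x : ℝ) :
    scoreDeficit α x ≤ 2 * α * phi x + g x := by
  have hp := phi_pos x
  have hg := g_pos x
  have hphi : α * phi x * phi x ≤ α * phi x * (2 * marginalDensity α x) := by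
    gcongr; exact phi_le_two_mul_marginalDensity h0 h1 x
  have hmix : g x * (α * g x) ≤ g x * marginalDensity α x := by
    gcongr; exact mul_g_le_marginalDensity (by linarith) x
  rw [scoreDeficit, div_le_iff₀ (marginalDensity_pos h0 (by linarith) x)]
  nlinarith [mul_nonneg h0 (mul_pos hp hg).le]

lemma scoreDeficit_le_add_sq_div {α : ℝ} (h0 : 0 ≤ α) (h1 : α ≤ 1 / 2) (x : ℝ) :
    scoreDeficit α x ≤ 2 * α * phi x + 2 * α * (g x ^ 2 / phi x) := by
  have hp := phi_pos x
  calc scoreDeficit α x ≤ α * (g x - phi x) ^ 2 / (phi x / 2) := by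
        unfold scoreDeficit
        gcongr
        linarith [phi_le_two_mul_marginalDensity h0 h1 x]
    _ ≤ α * (g x ^ 2 + phi x ^ 2) / (phi x / 2) := by
        gcongr
        nlinarith [mul_pos hp (g_pos x)]
    _ = 2 * α * phi x + 2 * α * (g x ^ 2 / phi x) := by field_simp; ring

lemma integrable_scoreDeficit {α : ℝ} (h0 : 0 ≤ α) (h1 : α ≤ 1 / 2) :
    Integrable (scoreDeficit α) := by
  refine ((integrable_phi.const_mul (2 * α)).add integrable_g).mono' (by fun_prop)
    (ae_of_all _ fun x => ?_)
  rw [Real.norm_of_nonneg (scoreDeficit_nonneg h0 (by linarith) x)]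
  exact scoreDeficit_le_add_g h0 h1 x

lemma integral_score_gaussianReal {α : ℝ} (h0 : 0 ≤ α) (h1 : α ≤ 1 / 2) :
    ∫ x, score α x ∂gaussianReal 0 1 = -∫ x, scoreDeficit α x := by
  calc ∫ x, score α x ∂gaussianReal 0 1 = ∫ x, phi x * score α x :=
        integral_gaussianReal_eq_integral_smul one_ne_zero
    _ = ∫ x, (g x - phi x - scoreDeficit α x) := by
        simp_rw [phi_mul_score h0 (h1.trans (by norm_num))]
    _ = -∫ x, scoreDeficit α x := by
        have hgphi : Integrable fun x => g x - phi x := integrable_g.sub integrable_phi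
        rw [integral_sub hgphi (integrable_scoreDeficit h0 h1),
          integral_sub integrable_g integrable_phi, integral_g, integral_phi]
        ring

lemma variance_score_gaussianReal_le {α : ℝ} (h0 : 0 < α) (h1 : α ≤ 1 / 2) :
    Var[score α; gaussianReal 0 1] ≤ 2 / α * ∫ x, scoreDeficit α x := by
  calc Var[score α; gaussianReal 0 1] ≤ ∫ x, score α x ^ 2 ∂gaussianReal 0 1 :=
        variance_le_expectation_sq (by fun_prop)
    _ = ∫ x, phi x * score α x ^ 2 := integral_gaussianReal_eq_integral_smul one_ne_zero
    _ ≤ ∫ x, 2 / α * scoreDeficit α x :=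
        integral_mono_of_nonneg (ae_of_all _ fun x => mul_nonneg (phi_pos x).le (sq_nonneg _))
          ((integrable_scoreDeficit h0.le h1).const_mul _)
          (ae_of_all _ fun x => phi_mul_score_sq_le h0 h1 x)
    _ = 2 / α * ∫ x, scoreDeficit α x := integral_const_mul _ _

lemma g_sq_div_phi_le (x : ℝ) :
    g x ^ 2 / phi x ≤ 3 * Real.exp (4 - 2 * |x| + x ^ 2 / 2) := by
  rw [div_le_iff₀ (phi_pos x)]
  calc g x ^ 2 ≤ Real.exp (2 - |x|) ^ 2 := pow_le_pow_left₀ (g_nonneg x) (g_le_exp x) 2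
    _ = 3 * Real.exp (4 - 2 * |x| + x ^ 2 / 2) * (Real.exp (-(x ^ 2 / 2)) / 3) := by
        rw [mul_div_assoc', mul_assoc, ← Real.exp_add, ← Real.exp_nat_mul]
        push_cast
        rw [mul_div_cancel_left₀ _ three_ne_zero]
        ring_nf
    _ ≤ 3 * Real.exp (4 - 2 * |x| + x ^ 2 / 2) * phi x := by
        gcongr; exact exp_div_three_le_phi x

-- For `|x| ≤ T` the term `α g² / φ` is the smaller one, for `|x| ≥ T` it is `g`.
lemma scoreDeficit_le {T : ℝ} (hT : 2 ≤ T) (x : ℝ) :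
    scoreDeficit (Real.exp (-(T ^ 2 / 2))) x ≤ 2 * Real.exp (-(T ^ 2 / 2)) * phi x +
      6 * Real.exp (4 - 9 / 10 * T) * Real.exp (-(1 / 10) * |x|) := by
  have h0 := (Real.exp_pos (-(T ^ 2 / 2))).le
  have h1 : Real.exp (-(T ^ 2 / 2)) ≤ 1 / 2 := exp_le_half_of_le_neg_one (by nlinarith)
  rw [mul_assoc 6, ← Real.exp_add]
  rcases le_total |x| T with hx | hx
  · refine (scoreDeficit_le_add_sq_div h0 h1 x).trans (add_le_add le_rfl ?_)
    have hexp : -(T ^ 2 / 2) + (4 - 2 * |x| + x ^ 2 / 2) ≤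
        4 - 9 / 10 * T + -(1 / 10) * |x| := by
      rw [← sq_abs x]
      nlinarith [abs_nonneg x, mul_nonneg (sub_nonneg.2 hx)
        (by linarith [abs_nonneg x] : 0 ≤ T + |x| - 2)]
    calc 2 * Real.exp (-(T ^ 2 / 2)) * (g x ^ 2 / phi x)
        ≤ 2 * Real.exp (-(T ^ 2 / 2)) * (3 * Real.exp (4 - 2 * |x| + x ^ 2 / 2)) := by
          gcongr; exact g_sq_div_phi_le x
      _ = 6 * Real.exp (-(T ^ 2 / 2) + (4 - 2 * |x| + x ^ 2 / 2)) := by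
          rw [Real.exp_add (-(T ^ 2 / 2))]; ring
      _ ≤ 6 * Real.exp (4 - 9 / 10 * T + -(1 / 10) * |x|) := by gcongr
  · refine (scoreDeficit_le_add_g h0 h1 x).trans (add_le_add le_rfl ?_)
    calc g x ≤ Real.exp (2 - |x|) := g_le_exp x
      _ ≤ Real.exp (4 - 9 / 10 * T + -(1 / 10) * |x|) := by gcongr; linarith
      _ ≤ 6 * Real.exp (4 - 9 / 10 * T + -(1 / 10) * |x|) :=
          le_mul_of_one_le_left (Real.exp_pos _).le (by norm_num)

lemma integral_scoreDeficit_le {T : ℝ} (hT : 2 ≤ T) :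
    ∫ x, scoreDeficit (Real.exp (-(T ^ 2 / 2))) x ≤
      2 * Real.exp (-(T ^ 2 / 2)) + 120 * Real.exp (4 - 9 / 10 * T) := by
  have h0 := (Real.exp_pos (-(T ^ 2 / 2))).le
  have h1 : Real.exp (-(T ^ 2 / 2)) ≤ 1 / 2 := exp_le_half_of_le_neg_one (by nlinarith)
  have hphi := integrable_phi.const_mul (2 * Real.exp (-(T ^ 2 / 2)))
  have hexp := (integrable_exp_neg_mul_abs (by norm_num : (0 : ℝ) < 1 / 10)).const_mul
    (6 * Real.exp (4 - 9 / 10 * T))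
  refine (integral_mono (integrable_scoreDeficit h0 h1) (hphi.add hexp)
    (scoreDeficit_le hT)).trans_eq ?_
  rw [integral_add' hphi hexp, integral_const_mul, integral_const_mul, integral_phi,
    integral_exp_neg_mul_abs (by norm_num)]
  ring

lemma tendsto_exp_mul_integral_scoreDeficit :
    Tendsto (fun r => Real.exp r * ∫ x, scoreDeficit (Real.exp (r - r ^ 2)) x) atTop (𝓝 0) := by
  have hlim : Tendsto (fun r : ℝ => (2 + 120 * Real.exp 4) * Real.exp (-(r / 10)))
      atTop (𝓝 0) := by
    simpa using (Real.tendsto_exp_neg_atTop_nhds_zero.comp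
      (tendsto_id.atTop_div_const (by norm_num : (0 : ℝ) < 10))).const_mul (2 + 120 * Real.exp 4)
  refine squeeze_zero' ?_ ?_ hlim
  · filter_upwards [eventually_ge_atTop 1] with r hr
    exact mul_nonneg (Real.exp_pos _).le (integral_nonneg
      (scoreDeficit_nonneg (Real.exp_pos _).le (Real.exp_le_one_iff.2 (by nlinarith))))
  · filter_upwards [eventually_ge_atTop 10] with r hr
    set T := √(2 * (r ^ 2 - r)) with hT
    have hTr : 13 / 10 * r ≤ T := Real.le_sqrt_of_sq_le (by nlinarith)
    have hTsq : r - r ^ 2 = -(T ^ 2 / 2) := by rw [hT, Real.sq_sqrt (by nlinarith)]; ring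
    calc Real.exp r * ∫ x, scoreDeficit (Real.exp (r - r ^ 2)) x
        ≤ Real.exp r * (2 * Real.exp (r - r ^ 2) + 120 * Real.exp (4 - 9 / 10 * T)) := by
          rw [hTsq]
          gcongr
          exact integral_scoreDeficit_le (by linarith)
      _ = 2 * Real.exp (r + (r - r ^ 2)) + 120 * Real.exp (4 + (r - 9 / 10 * T)) := by
          rw [show 4 + (r - 9 / 10 * T) = r + (4 - 9 / 10 * T) by ring, Real.exp_add r,
            Real.exp_add r]
          ring
      _ ≤ 2 * Real.exp (-(r / 10)) + 120 * Real.exp (4 + -(r / 10)) := by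
          gcongr
          · nlinarith
          · linarith
      _ = (2 + 120 * Real.exp 4) * Real.exp (-(r / 10)) := by rw [Real.exp_add]; ring

/-! ### The marginal maximum likelihood estimator -/

/-- `α` maximises the log-marginal likelihood over `[a, 1]`, for an arbitrary lower end point `a`
in place of the `α_n` of `IsMMLE`. -/
def IsMMLEFrom (a : ℝ) {n : ℕ} (x : Fin n → ℝ) (α : ℝ) : Prop :=
  α ∈ Set.Icc a 1 ∧ IsMaxOn (logMarginalLikelihood x) (Set.Icc a 1) α

lemma sub_mul_score_le_log_sub_log {α β : ℝ} (hα0 : 0 ≤ α) (hα1 : α ≤ 1) (hβ0 : 0 ≤ β)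
    (hβ1 : β ≤ 1) (x : ℝ) :
    (α - β) * score α x ≤
      Real.log (marginalDensity α x) - Real.log (marginalDensity β x) := by
  have hmα := marginalDensity_pos hα0 hα1 x
  have hmβ := marginalDensity_pos hβ0 hβ1 x
  have hlog := Real.log_le_sub_one_of_pos (div_pos hmβ hmα)
  rw [Real.log_div hmβ.ne' hmα.ne'] at hlog
  have hscore : (α - β) * score α x = 1 - marginalDensity β x / marginalDensity α x := by
    unfold score
    field_simp
    unfold marginalDensity
    ring
  linarith

lemma IsMMLEFrom.le_of_sum_score_pos {n : ℕ} {x : Fin n → ℝ} {a α β : ℝ} (ha : 0 ≤ a)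
    (hα : α ≤ 1) (hscore : 0 < ∑ i, score α (x i)) (hβ : IsMMLEFrom a x β) : α ≤ β := by
  by_contra! hlt
  obtain ⟨⟨haβ, hβ1⟩, hmax⟩ := hβ
  have hle : logMarginalLikelihood x α ≤ logMarginalLikelihood x β :=
    hmax ⟨haβ.trans hlt.le, hα⟩
  have hβ0 : 0 ≤ β := ha.trans haβ
  have hsum : (α - β) * ∑ i, score α (x i) ≤
      logMarginalLikelihood x α - logMarginalLikelihood x β := by
    unfold logMarginalLikelihood
    rw [Finset.mul_sum, ← Finset.sum_sub_distrib]
    exact Finset.sum_le_sum fun i _ =>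
      sub_mul_score_le_log_sub_log (hβ0.trans hlt.le) hα hβ0 hβ1 (x i)
  linarith [mul_pos (sub_pos.2 hlt) hscore]

/-! ### The posterior second moment -/

lemma slabWeight_nonneg {α : ℝ} (h0 : 0 ≤ α) (h1 : α ≤ 1) (x : ℝ) : 0 ≤ slabWeight α x :=
  div_nonneg (mul_nonneg h0 (g_nonneg x)) (marginalDensity_pos h0 h1 x).le

lemma slabWeight_le_one {α : ℝ} (h0 : 0 ≤ α) (h1 : α ≤ 1) (x : ℝ) : slabWeight α x ≤ 1 :=
  div_le_one_of_le₀ (mul_g_le_marginalDensity h1 x) (marginalDensity_pos h0 h1 x).le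

instance (x : ℝ) : IsProbabilityMeasure (slabPosterior x) := by
  refine ⟨?_⟩
  rw [slabPosterior, withDensity_apply _ MeasurableSet.univ, Measure.restrict_univ,
    ← ofReal_integral_eq_lintegral_ofReal ((integrable_phi_mul_laplaceDensity x).div_const _)
      (ae_of_all _ fun u => div_nonneg (phi_mul_laplaceDensity_pos x u).le (g_nonneg x)),
    integral_div, ← g_eq_integral, div_self (g_pos x).ne', ENNReal.ofReal_one]

lemma isProbabilityMeasure_coordPosterior {α : ℝ} (h0 : 0 ≤ α) (h1 : α ≤ 1) (x : ℝ) :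
    IsProbabilityMeasure (coordPosterior α x) := by
  refine ⟨?_⟩
  simp only [coordPosterior, Measure.coe_add, Measure.coe_smul, Pi.add_apply, Pi.smul_apply,
    measure_univ, smul_eq_mul, mul_one]
  rw [← ENNReal.ofReal_add (sub_nonneg.2 (slabWeight_le_one h0 h1 x)) (slabWeight_nonneg h0 h1 x),
    sub_add_cancel, ENNReal.ofReal_one]

lemma le_lintegral_sq_slabPosterior (x : ℝ) :
    ENNReal.ofReal (Real.exp (-4 - |x|) / 6 / g x) ≤
      ∫⁻ u, ENNReal.ofReal (u ^ 2) ∂slabPosterior x := by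
  obtain ⟨c, hc⟩ : ∃ c, ∀ u ∈ Set.Icc c (c + 1), |x - u| ≤ 2 ∧ 1 ≤ u ^ 2 := by
    rcases le_total 0 x with hx | hx
    · refine ⟨x + 1, fun u hu => ⟨abs_le.2 ⟨?_, ?_⟩, ?_⟩⟩ <;> nlinarith [hu.1, hu.2]
    · refine ⟨x - 2, fun u hu => ⟨abs_le.2 ⟨?_, ?_⟩, ?_⟩⟩ <;> nlinarith [hu.1, hu.2]
  have hg := g_pos x
  rw [slabPosterior, lintegral_withDensity_eq_lintegral_mul _ (by fun_prop) (by fun_prop)]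
  calc ENNReal.ofReal (Real.exp (-4 - |x|) / 6 / g x)
      = ∫⁻ _ in Set.Icc c (c + 1), ENNReal.ofReal (Real.exp (-4 - |x|) / 6 / g x) := by simp
    _ ≤ ∫⁻ u in Set.Icc c (c + 1),
          ENNReal.ofReal (phi (x - u) * laplaceDensity u / g x) * ENNReal.ofReal (u ^ 2) := by
        refine setLIntegral_mono' measurableSet_Icc fun u hu => ?_
        refine le_mul_of_le_of_one_le (ENNReal.ofReal_le_ofReal ?_)
          (ENNReal.one_le_ofReal.2 (hc u hu).2)
        gcongr
        exact exp_div_six_le_phi_mul_laplaceDensity (hc u hu).1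
    _ ≤ _ := setLIntegral_le_lintegral _ _

lemma le_lintegral_sq_coordPosterior {α : ℝ} (h0 : 0 ≤ α) (h1 : α ≤ 1) (x : ℝ) :
    ENNReal.ofReal (Real.exp (-6) / 6 * α) ≤ ∫⁻ u, ENNReal.ofReal (u ^ 2) ∂coordPosterior α x := by
  have hg := g_pos x
  have hm := marginalDensity_pos h0 h1 x
  have hweight : Real.exp (-6) / 6 * α ≤ slabWeight α x * (Real.exp (-4 - |x|) / 6 / g x) := by
    calc Real.exp (-6) / 6 * α = α * (Real.exp (-4 - |x|) / 6) / Real.exp (2 - |x|) := by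
          rw [show -4 - |x| = -6 + (2 - |x|) by ring, Real.exp_add]; field_simp
      _ ≤ α * (Real.exp (-4 - |x|) / 6) / marginalDensity α x := by
          gcongr; exact marginalDensity_le_exp h0 h1 x
      _ = slabWeight α x * (Real.exp (-4 - |x|) / 6 / g x) := by unfold slabWeight; field_simp
  calc ENNReal.ofReal (Real.exp (-6) / 6 * α)
      ≤ ENNReal.ofReal (slabWeight α x) * ENNReal.ofReal (Real.exp (-4 - |x|) / 6 / g x) := by
        rw [← ENNReal.ofReal_mul (slabWeight_nonneg h0 h1 x)]
        exact ENNReal.ofReal_le_ofReal hweight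
    _ ≤ ENNReal.ofReal (slabWeight α x) * ∫⁻ u, ENNReal.ofReal (u ^ 2) ∂slabPosterior x := by
        gcongr; exact le_lintegral_sq_slabPosterior x
    _ ≤ ∫⁻ u, ENNReal.ofReal (u ^ 2) ∂coordPosterior α x := by
        rw [coordPosterior, lintegral_add_measure, lintegral_smul_measure, lintegral_smul_measure,
          smul_eq_mul, smul_eq_mul]
        exact le_add_self

lemma sum_lintegral_sq_le_lintegral_posterior {n : ℕ} {α : ℝ} (h0 : 0 ≤ α) (h1 : α ≤ 1)
    (x θ₀ : Fin n → ℝ) {N : Finset (Fin n)} (hN : ∀ i ∈ N, θ₀ i = 0) :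
    ∑ i ∈ N, ∫⁻ u, ENNReal.ofReal (u ^ 2) ∂coordPosterior α (x i) ≤
      ∫⁻ θ, ENNReal.ofReal (∑ i, (θ i - θ₀ i) ^ 2) ∂posterior α x := by
  have hprob (i : Fin n) : IsProbabilityMeasure (coordPosterior α (x i)) :=
    isProbabilityMeasure_coordPosterior h0 h1 (x i)
  have hcoord (i : Fin n) : ∫⁻ u, ENNReal.ofReal (u ^ 2) ∂coordPosterior α (x i) =
      ∫⁻ θ, ENNReal.ofReal (θ i ^ 2) ∂posterior α x :=
    ((measurePreserving_eval (fun i => coordPosterior α (x i)) i).lintegral_comp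
      (f := fun u : ℝ => ENNReal.ofReal (u ^ 2)) (by fun_prop)).symm
  simp_rw [hcoord]
  rw [← lintegral_finsetSum _ fun i _ => by fun_prop]
  refine lintegral_mono fun θ => ?_
  rw [← ENNReal.ofReal_sum_of_nonneg fun i _ => sq_nonneg _]
  refine ENNReal.ofReal_le_ofReal ?_
  calc ∑ i ∈ N, θ i ^ 2 = ∑ i ∈ N, (θ i - θ₀ i) ^ 2 :=
        Finset.sum_congr rfl fun i hi => by rw [hN i hi, sub_zero]
    _ ≤ ∑ i, (θ i - θ₀ i) ^ 2 :=
        Finset.sum_le_sum_of_subset_of_nonneg (Finset.subset_univ _) fun _ _ _ => sq_nonneg _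

lemma le_lintegral_posterior {n s : ℕ} {α : ℝ} (h0 : 0 ≤ α) (h1 : α ≤ 1) (x : Fin n → ℝ)
    {θ₀ : Fin n → ℝ} (hθ₀ : θ₀ ∈ nearlyBlack n s) :
    ENNReal.ofReal ((n - s) * (Real.exp (-6) / 6 * α)) ≤
      ∫⁻ θ, ENNReal.ofReal (∑ i, (θ i - θ₀ i) ^ 2) ∂posterior α x := by
  set N : Finset (Fin n) := {i | θ₀ i = 0} with hN
  have hcard : (n : ℝ) - s ≤ N.card := by
    have hsum : N.card + (Finset.univ.filter fun i => θ₀ i ≠ 0).card = n := by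
      simpa using Finset.card_filter_add_card_filter_not (s := Finset.univ) (fun i => θ₀ i = 0)
    have hle : (Finset.univ.filter fun i => θ₀ i ≠ 0).card ≤ s := hθ₀
    rw [sub_le_iff_le_add]
    exact_mod_cast (by omega : n ≤ N.card + s)
  calc ENNReal.ofReal ((n - s) * (Real.exp (-6) / 6 * α))
      ≤ ENNReal.ofReal (N.card * (Real.exp (-6) / 6 * α)) := by gcongr
    _ = ∑ _i ∈ N, ENNReal.ofReal (Real.exp (-6) / 6 * α) := by
        rw [Finset.sum_const, nsmul_eq_mul, ENNReal.ofReal_mul (by positivity),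
          ENNReal.ofReal_natCast]
    _ ≤ ∑ i ∈ N, ∫⁻ u, ENNReal.ofReal (u ^ 2) ∂coordPosterior α (x i) :=
        Finset.sum_le_sum fun i _ => le_lintegral_sq_coordPosterior h0 h1 (x i)
    _ ≤ _ := sum_lintegral_sq_le_lintegral_posterior h0 h1 x θ₀ fun i hi =>
        (Finset.mem_filter.1 hi).2

lemma le_expectedSecondMoment {n s : ℕ} {α : ℝ} (h0 : 0 ≤ α) {θ₀ : Fin n → ℝ} (hsn : s ≤ n)
    (hθ₀ : θ₀ ∈ nearlyBlack n s) {A : Set (Fin n → ℝ)} (hA : MeasurableSet A)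
    {αhat : (Fin n → ℝ) → ℝ} (hhat : ∀ᵐ x ∂law θ₀, x ∈ A → αhat x ∈ Set.Icc α 1) :
    ENNReal.ofReal ((n - s) * (Real.exp (-6) / 6 * α)) * law θ₀ A ≤
      expectedSecondMoment αhat θ₀ := by
  have hsn' : (0 : ℝ) ≤ n - s := sub_nonneg.2 (by exact_mod_cast hsn)
  rw [← setLIntegral_const]
  refine (setLIntegral_mono_ae' hA ?_).trans (setLIntegral_le_lintegral _ _)
  filter_upwards [hhat] with x hx hxA
  obtain ⟨hα, h1⟩ := hx hxA
  refine le_trans (ENNReal.ofReal_le_ofReal ?_) (le_lintegral_posterior (h0.trans hα) h1 x hθ₀)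
  gcongr

/-! ### The lower bound -/

/-- The vector with `s` coordinates equal to `t` and the others zero: the unfavourable mean. -/
def signal (n s : ℕ) (t : ℝ) (i : Fin n) : ℝ := if i.val < s then t else 0

lemma signal_mem_nearlyBlack (n s : ℕ) (t : ℝ) : signal n s t ∈ nearlyBlack n s := by
  change (Finset.univ.filter fun i => signal n s t i ≠ 0).card ≤ s
  calc (Finset.univ.filter fun i => signal n s t i ≠ 0).card
      ≤ (Finset.univ.filter fun i : Fin n => i.val < s).card :=
        Finset.card_le_card (Finset.monotone_filter_right _ fun i _ hi => by
          by_contra h; exact hi (if_neg h))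
    _ ≤ s := by rw [Fin.card_filter_val_lt]; exact min_le_right n s

lemma sum_comp_signal {n s : ℕ} (hsn : s ≤ n) (t : ℝ) (F : ℝ → ℝ) :
    ∑ i, F (signal n s t i) = s * F t + (n - s) * F 0 := by
  have hlt : (Finset.univ.filter fun i : Fin n => i.val < s).card = s := by
    rw [Fin.card_filter_val_lt, min_eq_right hsn]
  have hge : (Finset.univ.filter fun i : Fin n => ¬ i.val < s).card = n - s := by
    rw [Finset.filter_not, Finset.card_sdiff_of_subset (Finset.filter_subset _ _), hlt,
      Finset.card_univ, Fintype.card_fin]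
  simp only [signal, apply_ite F, Finset.sum_ite, Finset.sum_const, nsmul_eq_mul]
  rw [hlt, hge, Nat.cast_sub hsn]

instance {n : ℕ} (θ : Fin n → ℝ) : IsProbabilityMeasure (law θ) := by
  unfold law; infer_instance

lemma law_signal_sum_score_nonpos_le {n s : ℕ} {α t : ℝ} (h0 : 0 < α) (h1 : α ≤ 1 / 2)
    (hs : 1 ≤ s) (hsn : s ≤ n) (hdef : n * α * ∫ x, scoreDeficit α x ≤ s / 128)
    (hmean : 1 / (2 * α) ≤ ∫ x, score α x ∂gaussianReal t 1)
    (hvar : Var[score α; gaussianReal t 1] ≤ 1 / (64 * α ^ 2)) :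
    law (signal n s t) {x | ∑ i, score α (x i) ≤ 0} ≤ 1 / 2 := by
  set δ := ∫ x, scoreDeficit α x
  have hδ0 : 0 ≤ δ := integral_nonneg (scoreDeficit_nonneg h0.le (by linarith))
  have hs1 : (1 : ℝ) ≤ s := by exact_mod_cast hs
  have hsn' : (s : ℝ) ≤ n := by exact_mod_cast hsn
  have hnδ : n * δ ≤ s / (128 * α) := by
    rw [le_div_iff₀ (by positivity)]
    linarith
  have hM : s / (4 * α) ≤ ∑ i, ∫ x, score α x ∂gaussianReal (signal n s t i) 1 := by
    rw [sum_comp_signal hsn t fun θ => ∫ x, score α x ∂gaussianReal θ 1,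
      integral_score_gaussianReal h0.le h1]
    calc s / (4 * α) ≤ s * (1 / (2 * α)) - s / (128 * α) := by
          rw [← sub_nonneg]
          have : s * (1 / (2 * α)) - s / (128 * α) - s / (4 * α) = 31 * s / (128 * α) := by
            field_simp; ring
          rw [this]
          positivity
      _ ≤ s * (1 / (2 * α)) - n * δ := by gcongr
      _ ≤ s * (∫ x, score α x ∂gaussianReal t 1) + (n - s) * -δ := by
          nlinarith [mul_le_mul_of_nonneg_left hmean (by linarith : (0 : ℝ) ≤ s)]
  have hV : ∑ i, Var[score α; gaussianReal (signal n s t i) 1] ≤ s / (32 * α ^ 2) := by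
    rw [sum_comp_signal hsn t fun θ => Var[score α; gaussianReal θ 1]]
    calc s * Var[score α; gaussianReal t 1] + (n - s) * Var[score α; gaussianReal 0 1]
        ≤ s * (1 / (64 * α ^ 2)) + (n - s) * (2 / α * δ) := by
          gcongr
          exact variance_score_gaussianReal_le h0 h1
      _ ≤ s * (1 / (64 * α ^ 2)) + 2 / α * (n * δ) := by
          nlinarith [mul_nonneg (by linarith : (0 : ℝ) ≤ s) (by positivity : 0 ≤ 2 / α * δ)]
      _ ≤ s * (1 / (64 * α ^ 2)) + 2 / α * (s / (128 * α)) := by gcongr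
      _ = s / (32 * α ^ 2) := by field_simp; norm_num
  refine (measure_pi_sum_nonpos_le (fun i => memLp_score h0 h1 2 _) (by positivity) hM).trans ?_
  rw [← ENNReal.ofReal_one, ← ENNReal.ofReal_ofNat 2, ← ENNReal.ofReal_div_of_pos two_pos]
  refine ENNReal.ofReal_le_ofReal ?_
  rw [div_le_iff₀ (by positivity)]
  calc _ ≤ s / (32 * α ^ 2) := hV
    _ ≤ s * s / (32 * α ^ 2) := by gcongr; exact le_mul_of_one_le_left (by positivity) hs1
    _ = 1 / 2 * (s / (4 * α)) ^ 2 := by field_simp; norm_num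

lemma exists_le_expectedSecondMoment {n s : ℕ} {α : ℝ} (h0 : 0 < α) (h1 : α ≤ 1 / 2) (hs : 1 ≤ s)
    (hsn : s ≤ n) (hdef : n * α * ∫ x, scoreDeficit α x ≤ s / 128) :
    ∃ θ₀ ∈ nearlyBlack n s, ∀ a : ℝ, 0 ≤ a → ∀ αhat : (Fin n → ℝ) → ℝ,
      (∀ᵐ x ∂law θ₀, IsMMLEFrom a x (αhat x)) →
        ENNReal.ofReal ((n - s) * (Real.exp (-6) / 12 * α)) ≤ expectedSecondMoment αhat θ₀ := by
  obtain ⟨t, hmean, hvar⟩ := exists_score_moments h0 h1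
  refine ⟨signal n s t, signal_mem_nearlyBlack n s t, fun a ha αhat hhat => ?_⟩
  set B : Set (Fin n → ℝ) := {x | ∑ i, score α (x i) ≤ 0}
  have hB : MeasurableSet B := measurableSet_le (by fun_prop) measurable_const
  have hprob : 1 / 2 ≤ law (signal n s t) Bᶜ := by
    rw [prob_compl_eq_one_sub hB]
    calc (1 / 2 : ENNReal) = 1 - 1 / 2 := by rw [one_div, ENNReal.one_sub_inv_two]
      _ ≤ _ := tsub_le_tsub_left (law_signal_sum_score_nonpos_le h0 h1 hs hsn hdef hmean hvar) 1
  calc ENNReal.ofReal ((n - s) * (Real.exp (-6) / 12 * α))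
      = ENNReal.ofReal ((n - s) * (Real.exp (-6) / 6 * α) * (1 / 2)) := by ring_nf
    _ = ENNReal.ofReal ((n - s) * (Real.exp (-6) / 6 * α)) * (1 / 2) := by
        rw [ENNReal.ofReal_mul' (by norm_num), ENNReal.ofReal_div_of_pos two_pos,
          ENNReal.ofReal_one, ENNReal.ofReal_ofNat]
    _ ≤ ENNReal.ofReal ((n - s) * (Real.exp (-6) / 6 * α)) * law (signal n s t) Bᶜ := by gcongr
    _ ≤ expectedSecondMoment αhat (signal n s t) :=
        le_expectedSecondMoment h0.le hsn (signal_mem_nearlyBlack n s t) hB.compl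
          (hhat.mono fun x hx hxB =>
            ⟨hx.le_of_sum_score_pos ha (by linarith) (not_le.1 hxB), hx.1.2⟩)

-- Here `r = √(log (n / s))` and the weight below the estimator is `(s / n) exp r = exp (r - r²)`.
lemma eventually_exists_le_expectedSecondMoment :
    ∀ᶠ r : ℝ in atTop, ∀ n s : ℕ, 1 ≤ s → (n : ℝ) = s * Real.exp (r ^ 2) →
      ∃ θ₀ ∈ nearlyBlack n s, ∀ a : ℝ, 0 ≤ a → ∀ αhat : (Fin n → ℝ) → ℝ,
        (∀ᵐ x ∂law θ₀, IsMMLEFrom a x (αhat x)) →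
          ENNReal.ofReal (Real.exp (-6) / 24 * s * Real.exp r) ≤
            expectedSecondMoment αhat θ₀ := by
  filter_upwards [eventually_ge_atTop 2, tendsto_exp_mul_integral_scoreDeficit.eventually_le_const
    (by norm_num : (0 : ℝ) < 1 / 128)] with r hr hdef n s hs hn
  set α := Real.exp (r - r ^ 2)
  have h0 : 0 < α := Real.exp_pos _
  have h1 : α ≤ 1 / 2 := exp_le_half_of_le_neg_one (by nlinarith)
  have hnα : n * α = s * Real.exp r := by
    rw [hn, mul_assoc, ← Real.exp_add, add_sub_cancel]
  have hsn : 2 * (s : ℝ) ≤ n := by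
    rw [hn, mul_comm]
    gcongr
    nlinarith [Real.add_one_le_exp (r ^ 2)]
  have hsn' : s ≤ n := by
    have : (s : ℝ) ≤ n := by linarith [s.cast_nonneg (α := ℝ)]
    exact_mod_cast this
  have hδ : n * α * ∫ x, scoreDeficit α x ≤ s / 128 := by
    rw [hnα, mul_assoc, div_eq_mul_one_div]
    gcongr
  obtain ⟨θ₀, hθ₀, h⟩ := exists_le_expectedSecondMoment h0 h1 hs hsn' hδ
  refine ⟨θ₀, hθ₀, fun a ha αhat hhat => (ENNReal.ofReal_le_ofReal ?_).trans (h a ha αhat hhat)⟩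
  rw [mul_assoc, ← hnα]
  linarith [mul_nonneg (mul_pos (Real.exp_pos (-6)) h0).le (sub_nonneg.2 hsn)]

lemma eventually_mul_sq_le_mul_exp (K : ℝ) {D : ℝ} (hD : 0 < D) :
    ∀ᶠ r : ℝ in atTop, K * r ^ 2 ≤ D * Real.exp r := by
  filter_upwards [(Real.tendsto_exp_div_pow_atTop 2).eventually_ge_atTop (K / D),
    eventually_gt_atTop 0] with r hr hr0
  rw [div_le_div_iff₀ hD (by positivity)] at hr
  linarith

lemma alphaLower_nonneg (n : ℕ) : 0 ≤ alphaLower n := Real.sInf_nonneg fun _ hα => hα.1.1.le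

end SpikeSlab

theorem theorem1_general :
    ∃ D c₀ : ℝ, 0 < D ∧ 0 < c₀ ∧
      (∀ n s : ℕ, 1 ≤ s → (s : ℝ) ≤ c₀ * n →
        ∃ θ₀ ∈ SpikeSlab.nearlyBlack n s, ∀ a : ℝ, 0 ≤ a → ∀ αhat : (Fin n → ℝ) → ℝ,
          (∀ᵐ x ∂SpikeSlab.law θ₀, SpikeSlab.IsMMLEFrom a x (αhat x)) →
            ENNReal.ofReal (D * s * Real.exp (Real.sqrt (Real.log ((n : ℝ) / s)))) ≤
              SpikeSlab.expectedSecondMoment αhat θ₀) ∧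
      (∀ K : ℝ, ∃ c : ℝ, 0 < c ∧ ∀ n s : ℕ, 1 ≤ s → (s : ℝ) ≤ c * n →
        ∃ θ₀ ∈ SpikeSlab.nearlyBlack n s, ∀ a : ℝ, 0 ≤ a → ∀ αhat : (Fin n → ℝ) → ℝ,
          (∀ᵐ x ∂SpikeSlab.law θ₀, SpikeSlab.IsMMLEFrom a x (αhat x)) →
            ENNReal.ofReal (K * (s * Real.log ((n : ℝ) / s))) ≤
              SpikeSlab.expectedSecondMoment αhat θ₀) := by
  have hD : 0 < Real.exp (-6) / 24 := by positivity
  have hev := SpikeSlab.eventually_exists_le_expectedSecondMoment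
  obtain ⟨c₀, hc₀, hexp⟩ := SpikeSlab.exists_forall_of_eventually_sqrt_log hev
  refine ⟨Real.exp (-6) / 24, c₀, hD, hc₀, fun n s hs hsn => ?_, fun K => ?_⟩
  · obtain ⟨hr, hn⟩ := hexp s n (by positivity) hsn
    exact hr n s hs hn
  · obtain ⟨c, hc, hlog⟩ := SpikeSlab.exists_forall_of_eventually_sqrt_log
      (hev.and (SpikeSlab.eventually_mul_sq_le_mul_exp K hD))
    refine ⟨c, hc, fun n s hs hsn => ?_⟩
    obtain ⟨⟨hr, hK⟩, hn⟩ := hlog s n (by positivity) hsn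
    set r := √(Real.log (n / s))
    have hr2 : Real.log (n / s) = r ^ 2 := by
      rw [hn, mul_div_cancel_left₀ _ (by positivity), Real.log_exp]
    obtain ⟨θ₀, hθ₀, h⟩ := hr n s hs hn
    refine ⟨θ₀, hθ₀, fun a ha αhat hhat => le_trans (ENNReal.ofReal_le_ofReal ?_)
      (h a ha αhat hhat)⟩
    rw [hr2]
    nlinarith [(Nat.cast_nonneg s : (0 : ℝ) ≤ s)]

theorem theorem1 :
    ∃ (D : ℝ) (N₀ : ℕ) (c₀ : ℝ), 0 < D ∧ 0 < N₀ ∧ 0 < c₀ ∧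
      (∀ n : ℕ, N₀ ≤ n → ∀ s : ℕ, 1 ≤ s → (s : ℝ) ≤ c₀ * n →
        ∃ θ₀ ∈ SpikeSlab.nearlyBlack n s,
          ∀ αhat : (Fin n → ℝ) → ℝ, (∀ x, SpikeSlab.IsMMLE x (αhat x)) →
            ENNReal.ofReal (D * s * Real.exp (Real.sqrt (Real.log ((n : ℝ) / s)))) ≤
              SpikeSlab.expectedSecondMoment αhat θ₀) ∧
      (∀ K : ℝ, 0 < K → ∃ c : ℝ, 0 < c ∧
        ∀ n : ℕ, N₀ ≤ n → ∀ s : ℕ, 1 ≤ s → (s : ℝ) ≤ c * n →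
          ∃ θ₀ ∈ SpikeSlab.nearlyBlack n s,
            ∀ αhat : (Fin n → ℝ) → ℝ, (∀ x, SpikeSlab.IsMMLE x (αhat x)) →
              ENNReal.ofReal (K * (s * Real.log ((n : ℝ) / s))) ≤
                SpikeSlab.expectedSecondMoment αhat θ₀) := by
  obtain ⟨D, c₀, hD, hc₀, hexp, hlog⟩ := theorem1_general
  exact ⟨D, 1, c₀, hD, one_pos, hc₀, fun n _ s hs hsn => (hexp n s hs hsn).imp fun θ₀ h =>
      ⟨h.1, fun αhat hhat => h.2 _ (SpikeSlab.alphaLower_nonneg n) αhat (.of_forall hhat)⟩,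
    fun K _ => (hlog K).imp fun c hc => ⟨hc.1, fun n _ s hs hsn => (hc.2 n s hs hsn).imp
      fun θ₀ h => ⟨h.1, fun αhat hhat =>
        h.2 _ (SpikeSlab.alphaLower_nonneg n) αhat (.of_forall hhat)⟩⟩⟩
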